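/- Let $1\le k\le n-1$. Let $G_{n,k}$ be the Grassmann manifold of $k$-dimensional linear subspaces $\zeta$ of $\mathbb R^n$, with its $SO(n)$-invariant probability measure $d\zeta$. Every (affine, non-oriented) $k$-plane $\tau$ in $\mathbb R^n$ is written uniquely as $\tau=u+\zeta$ with $\zeta\in G_{n,k}$, $u\in\zeta^\perp$, and the manifold $\mathcal G_{n,k}$ of all $k$-planes carries the measure $d\tau=d\zeta\,du$, where $du$ is Lebesgue measure on $\zeta^\perp$. The $k$-plane transform of a function $f$ is $$(Rf)(\tau)=(Rf)(\zeta,u)=\int_\zeta f(u+v)\,dv ,$$ where $dv$ is Lebesgue measure on $\zeta$. Let $f$ be a real- or complex-valued function that is locally integrable on $\mathbb R^n\setminus\{0\}$, that is, Lebesgue integrable on every shell $\{x: a<|x|<b\}$, $0<a<b<\infty$. (i) If $$\int_{|x|>1}\frac{|f(x)|}{|x|^{n-k}}\,dx<\infty, \qquad (*)$$ then for almost every $\tau\in\mathcal G_{n,k}$ the integral $(Rf)(\tau)$ converges absolutely; in particular $(Rf)(\tau)$ is finite. (ii) If $f$ is nonnegative and radial, i.e. $f(x)=f_0(|x|)$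 for all $x\neq0$, and $(*)$ fails, then $(Rf)(\tau)=\infty$ for every $\tau\in\mathcal G_{n,k}$ (the restriction of $f$ to every $k$-plane being Lebesgue measurable). -/

import Mathlib

open MeasureTheory Topology
open scoped ENNReal ComplexOrder

namespace KPlane

noncomputable section

/-- The rotation group `SO(n)`: real `n × n` matrices `g` with `g gᵀ = gᵀ g = 1` and `det g = 1`
(the star operation on `ℝ` is trivial, so "special unitary over `ℝ`" is "special orthogonal"). -/
abbrev SO (n : ℕ) : Type := Matrix.specialUnitaryGroup (Fin n) ℝ

instance (n : ℕ) : IsTopologicalGroup (SO n) where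
  continuous_inv := by
    refine Continuous.subtype_mk (f := fun g : SO n => star (g : Matrix (Fin n) (Fin n) ℝ)) ?_ _
    exact continuous_star.comp continuous_subtype_val

theorem isClosed_SO (n : ℕ) :
    IsClosed (Matrix.specialUnitaryGroup (Fin n) ℝ : Set (Matrix (Fin n) (Fin n) ℝ)) := by
  have h1 : IsClosed (Matrix.unitaryGroup (Fin n) ℝ : Set (Matrix (Fin n) (Fin n) ℝ)) :=
    isClosed_unitary
  have h2 : IsClosed {g : Matrix (Fin n) (Fin n) ℝ | g.det = 1} :=
    isClosed_eq (Continuous.matrix_det continuous_id) continuous_const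
  exact h1.inter h2

instance (n : ℕ) : CompactSpace (SO n) := by
  refine isCompact_iff_compactSpace.mp ?_
  have hK : IsCompact (Set.pi Set.univ fun _ : Fin n =>
      Set.pi Set.univ fun _ : Fin n => Metric.closedBall (0 : ℝ) 1) :=
    isCompact_univ_pi fun _ => isCompact_univ_pi fun _ => isCompact_closedBall _ _
  refine hK.of_isClosed_subset ?_ ?_
  · exact isClosed_SO n
  · intro g hg i _ j _
    simpa using entry_norm_bound_of_unitary hg.1 i j

instance (n : ℕ) : MeasurableSpace (SO n) := borel _

instance (n : ℕ) : BorelSpace (SO n) := ⟨rfl⟩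

/-- The Haar probability measure on the compact group `SO(n)`. -/
def haarSO (n : ℕ) : Measure (SO n) := Measure.haarMeasure ⊤

instance (n : ℕ) : IsProbabilityMeasure (haarSO n) :=
  ⟨by simpa [haarSO] using
    Measure.haarMeasure_self (G := SO n) (K₀ := (⊤ : TopologicalSpace.PositiveCompacts (SO n)))⟩

/-- The action of a rotation `g ∈ SO(n)` on `ℝⁿ`, `x ↦ g x`. -/
def rotate {n : ℕ} (g : SO n) : EuclideanSpace ℝ (Fin n) ≃ₗᵢ[ℝ] EuclideanSpace ℝ (Fin n) :=
  Unitary.linearIsometryEquiv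
    ⟨Matrix.toEuclideanCLM (n := Fin n) (𝕜 := ℝ) g, Unitary.map_mem _ g.2.1⟩

theorem rotate_apply {n : ℕ} (g : SO n) (x : EuclideanSpace ℝ (Fin n)) :
    rotate g x = Matrix.toEuclideanCLM (n := Fin n) (𝕜 := ℝ) g x := rfl

/-- The Grassmann manifold of `k`-dimensional linear subspaces of `ℝⁿ`. -/
@[ext]
structure Gr (n k : ℕ) : Type where
  /-- The underlying linear subspace. -/
  space : Submodule ℝ (EuclideanSpace ℝ (Fin n))
  /-- The subspace has dimension `k`. -/
  finrank_space : Module.finrank ℝ space = k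

/-- The usual topology of the Grassmann manifold: a subspace is identified with the orthogonal
projection onto it. -/
instance (n k : ℕ) : TopologicalSpace (Gr n k) :=
  TopologicalSpace.induced (fun ζ => ζ.space.starProjection) inferInstance

instance (n k : ℕ) : MeasurableSpace (Gr n k) := borel _

instance (n k : ℕ) : BorelSpace (Gr n k) := ⟨rfl⟩

/-- The subspace `ℝᵏ = ℝ e₁ ⊕ ⋯ ⊕ ℝ eₖ` of `ℝⁿ`. -/
def coordPlane {n k : ℕ} (hk : k ≤ n) : Gr n k :=
  ⟨Submodule.span ℝ (Set.range fun i : Fin k =>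
      EuclideanSpace.single (Fin.castLE hk i) (1 : ℝ)), by
    have h : Orthonormal ℝ fun i : Fin k =>
        EuclideanSpace.single (Fin.castLE hk i) (1 : ℝ) :=
      (EuclideanSpace.orthonormal_single (𝕜 := ℝ) (ι := Fin n)).comp _ (Fin.castLE_injective hk)
    simpa using finrank_span_eq_card h.linearIndependent⟩

/-- The image `g ζ` of a `k`-dimensional subspace `ζ` under a rotation `g`. -/
def Gr.rotate {n k : ℕ} (g : SO n) (ζ : Gr n k) : Gr n k :=
  ⟨ζ.space.map ((KPlane.rotate g).toLinearEquiv : _ →ₗ[ℝ] _), by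
    rw [LinearEquiv.finrank_map_eq]; exact ζ.finrank_space⟩

theorem rotate_symm_apply {n : ℕ} (g : SO n) (x : EuclideanSpace ℝ (Fin n)) :
    (rotate g).symm x = Matrix.toEuclideanCLM (n := Fin n) (𝕜 := ℝ) (star g : SO n) x := by
  rw [LinearIsometryEquiv.symm_apply_eq, rotate_apply, ← mul_apply_eq_comp, ← map_mul]
  simp [g.2.1.2]

theorem starProjection_rotate {n k : ℕ} (g : SO n) (ζ : Gr n k) :
   (ζ.rotate g).space.starProjection = (Matrix.toEuclideanCLM (n := Fin n) (𝕜 := ℝ) g) ∘L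
     ζ.space.starProjection ∘L Matrix.toEuclideanCLM (n := Fin n) (𝕜 := ℝ) (star g : SO n) := by
  ext1 x
  refine (Submodule.starProjection_map_apply (KPlane.rotate g) ζ.space x).trans ?_
  rw [rotate_symm_apply]; rfl

theorem continuous_euclideanCLM {n : ℕ} : Continuous fun g : SO n =>
    Matrix.toEuclideanCLM (n := Fin n) (𝕜 := ℝ) (g : Matrix (Fin n) (Fin n) ℝ) := by
  have : Continuous ((Matrix.toEuclideanCLM (n := Fin n) (𝕜 := ℝ)).toAlgEquiv.toLinearMap) := 
    LinearMap.continuous_of_finiteDimensional _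
  exact this.comp continuous_subtype_val

theorem continuous_rotate {n k : ℕ} (ζ : Gr n k) :
    Continuous fun g : SO n => ζ.rotate g := by
  refine continuous_induced_rng.2 ?_
  have h := continuous_euclideanCLM (n := n)
  have : Continuous fun g : SO n => star g := continuous_inv
  have h2 : Continuous fun g : SO n => (Matrix.toEuclideanCLM (n := Fin n) (𝕜 := ℝ) g) ∘L
     ζ.space.starProjection ∘L Matrix.toEuclideanCLM (n := Fin n) (𝕜 := ℝ) (star g : SO n) := 
    h.clm_comp (continuous_const.clm_comp (h.comp this))
  exact h2.congr fun g => (starProjection_rotate g ζ).symm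

instance (n : ℕ) : SecondCountableTopology (SO n) := by
  have : SecondCountableTopology (Matrix (Fin n) (Fin n) ℝ) := 
    inferInstanceAs (SecondCountableTopology (Fin n → Fin n → ℝ))
  exact TopologicalSpace.Subtype.secondCountableTopology _

instance (n : ℕ) : PolishSpace (SO n) := by
  have : SecondCountableTopology (Matrix (Fin n) (Fin n) ℝ) := 
    inferInstanceAs (SecondCountableTopology (Fin n → Fin n → ℝ))
  have : TopologicalSpace.IsCompletelyMetrizableSpace (Matrix (Fin n) (Fin n) ℝ) :=
    inferInstanceAs (TopologicalSpace.IsCompletelyMetrizableSpace (Fin n → Fin n → ℝ))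
  have : PolishSpace (Matrix (Fin n) (Fin n) ℝ) := {}
  exact (isClosed_SO n).polishSpace

theorem isInducing_starProjection (n k : ℕ) :
    IsInducing fun ζ : Gr n k => ζ.space.starProjection := ⟨rfl⟩
 
instance (n k : ℕ) : SecondCountableTopology (Gr n k) :=
  (isInducing_starProjection n k).secondCountableTopology

instance (n k : ℕ) : T2Space (Gr n k) :=
  T2Space.of_injective_continuous (f := fun ζ : Gr n k => ζ.space.starProjection)
    (fun _ _ h => Gr.ext (Submodule.starProjection_inj.1 h))
    (isInducing_starProjection n k).continuous

theorem exists_rotate_coordPlane_of {n k : ℕ} (hk : k ≤ n) (ζ : Gr n k) : ∃ 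
    M ∈ Matrix.unitaryGroup (Fin n) ℝ, ∀ i : Fin k, 
      Matrix.toEuclideanCLM (n := Fin n) (𝕜 := ℝ) M (EuclideanSpace.single (Fin.castLE hk i) 1) ∈ ζ.space := by
  obtain ⟨ζ, rfl⟩ := ζ
  dsimp only
  let b := stdOrthonormalBasis ℝ ζ
  let v : Fin n → EuclideanSpace ℝ (Fin n) := fun i =>
    if h : (i : ℕ) < Module.finrank ℝ ζ then (b ⟨i, h⟩ : EuclideanSpace ℝ (Fin n)) else 0
  let s : Set (Fin n) := {i | (i : ℕ) < Module.finrank ℝ ζ}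
  have hv : Orthonormal ℝ (s.domRestrict v) := by
    have : s.domRestrict v = (fun j => (b j : EuclideanSpace ℝ (Fin n))) ∘ fun i : s => ⟨i, i.2⟩ := by
      ext1 i
      have := i.2
      simp only [s, Set.mem_ofPred_eq] at this
      simp [v, this, Set.domRestrict_apply]
    rw [this]
    refine (b.orthonormal.comp_linearIsometry ζ.subtypeₗᵢ).comp _ ?_
    intro i j h
    simpa [Fin.ext_iff, Subtype.ext_iff] using h
  obtain ⟨c, hc⟩ := hv.exists_orthonormalBasis_extension_of_card_eq (by simp)
  refine ⟨(EuclideanSpace.basisFun (Fin n) ℝ).toBasis.toMatrix c, OrthonormalBasis.toMatrix_orthonormalBasis_mem_unitary _ _, fun i => ?_⟩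
  have h1 : Matrix.toEuclideanCLM (n := Fin n) (𝕜 := ℝ) ((EuclideanSpace.basisFun (Fin n) ℝ).toBasis.toMatrix c) (EuclideanSpace.single (Fin.castLE hk i) 1) = c (Fin.castLE hk i) := by
    ext j
    simp [Module.Basis.toMatrix_apply]
  rw [h1, hc _ (by simp [s])]
  simp [v]

theorem rotate_surj {n k : ℕ} (hk : k ≤ n) :
    Function.Surjective fun g : SO n => (coordPlane hk).rotate g := by
  intro ζ
  suffices ∃ g : SO n, ∀ i : Fin k, rotate g (EuclideanSpace.single (Fin.castLE hk i) 1) ∈ ζ.space by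
    obtain ⟨g, hg⟩ := this
    refine ⟨g, Gr.ext ?_⟩
    refine Submodule.eq_of_le_of_finrank_eq ?_ ?_
    · change Submodule.map _ (Submodule.span _ _) ≤ _
      rw [Submodule.map_span_le]
      rintro _ ⟨i, rfl⟩
      exact hg i
    · exact ((coordPlane hk).rotate g).finrank_space.trans ζ.finrank_space.symm
  obtain ⟨M, hM, h⟩ := exists_rotate_coordPlane_of hk ζ
  have hdet : M.det * M.det = 1 := by
    have := (Matrix.det_of_mem_unitary hM).1
    simpa using this
  let d : Fin n → ℝ := fun i => if (i : ℕ) = 0 then M.det else 1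
  have hd : M.det * ∏ i, d i = 1 := by
    cases n with
    | zero => simp
    | succ n => simpa [d, Fin.prod_univ_succ] using hdet
  have hD : Matrix.diagonal d ∈ Matrix.unitaryGroup (Fin n) ℝ := by
    rw [Matrix.mem_unitaryGroup_iff, Matrix.star_eq_conjTranspose, Matrix.diagonal_conjTranspose,
      Matrix.diagonal_mul_diagonal, ← Matrix.diagonal_one]
    congr 1
    ext i
    by_cases hi : (i : ℕ) = 0 <;> simp [d, hi, hdet]
  refine ⟨⟨M * Matrix.diagonal d, mul_mem hM hD, ?_⟩, fun i => ?_⟩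
  · simpa [MonoidHom.mem_mker] using hd
  · have h1 : Matrix.toEuclideanCLM (n := Fin n) (𝕜 := ℝ) (Matrix.diagonal d)
        (EuclideanSpace.single (Fin.castLE hk i) 1) =
        d (Fin.castLE hk i) • EuclideanSpace.single (Fin.castLE hk i) (1 : ℝ) := by
      ext j
      by_cases hj : j = Fin.castLE hk i
      · subst hj; simp [Matrix.mulVec_diagonal]
      · simp [hj, Matrix.diagonal]
    rw [rotate_apply, map_mul, mul_apply_eq_comp, h1, map_smul]
    exact ζ.space.smul_mem _ (h i)

/-- The `SO(n)`-invariant probability measure on the Grassmann manifold: the law of `g ℝᵏ` for a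
Haar distributed rotation `g`. -/
def grMeasure {n k : ℕ} (hk : k ≤ n) : Measure (Gr n k) :=
  (haarSO n).map fun g => (coordPlane hk).rotate g

instance {n k : ℕ} (hk : k ≤ n) : IsProbabilityMeasure (grMeasure hk) :=
  Measure.isProbabilityMeasure_map (continuous_rotate _).measurable.aemeasurable

theorem measurable_rotate {n k : ℕ} (g : SO n) : Measurable fun ζ : Gr n k => ζ.rotate g := by
  refine Continuous.measurable (continuous_induced_rng.2 ?_)
  have h2 : Continuous fun ζ : Gr n k => (Matrix.toEuclideanCLM (n := Fin n) (𝕜 := ℝ) g) ∘L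
     ζ.space.starProjection ∘L Matrix.toEuclideanCLM (n := Fin n) (𝕜 := ℝ) (star g : SO n) :=
    continuous_const.clm_comp
      ((isInducing_starProjection n k).continuous.clm_comp continuous_const)
  exact h2.congr fun ζ => (starProjection_rotate g ζ).symm

theorem grMeasure_map_rotate {n k : ℕ} (hk : k ≤ n) (g : SO n) :
    (grMeasure hk).map (fun ζ => ζ.rotate g) = grMeasure hk := by
  have h1 : Measurable fun g : SO n => (coordPlane hk).rotate g := (continuous_rotate _).measurable
  have h2 : Measurable fun h : SO n => g * h := (continuous_const_mul g).measurable
  have h3 : (haarSO n).map (fun h => g * h) = haarSO n := by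
    rw [haarSO]; exact map_mul_left_eq_self _ g
  rw [grMeasure, Measure.map_map (measurable_rotate g) h1]
  conv_rhs => rw [← h3, Measure.map_map h1 h2]
  congr 1
  ext1 h
  refine Gr.ext ?_
  change Submodule.map _ (Submodule.map _ _) = Submodule.map _ _
  rw [← Submodule.map_comp]
  congr 1
  ext1 x
  change rotate g (rotate h x) = rotate (g * h) x
  simp only [rotate_apply, Submonoid.coe_mul, map_mul, mul_apply_eq_comp]

/-- The manifold of all non-oriented (affine) `k`-planes in `ℝⁿ`. The plane `τ = u + ζ` is
represented by the pair `(ζ, u)` of its direction `ζ` and its unique point `u ∈ ζᗮ`. -/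
structure Plane (n k : ℕ) : Type where
  /-- The direction `ζ` of the plane `u + ζ`. -/
  dir : Gr n k
  /-- The point `u` of the plane `u + ζ`. -/
  foot : EuclideanSpace ℝ (Fin n)
  /-- The point `u` is orthogonal to `ζ`. -/
  foot_mem : foot ∈ dir.spaceᗮ

/-- Measurable sets of planes: those given by Borel conditions on the pair `(ζ, u)`. -/
instance (n k : ℕ) : MeasurableSpace (Plane n k) :=
  MeasurableSpace.comap (fun τ => (τ.dir, τ.foot)) inferInstance

/-- The plane `u + ζ` for `u ∈ ζᗮ`. -/
def planeThrough {n k : ℕ} (ζ : Gr n k) (u : ζ.spaceᗮ) : Plane n k :=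
  ⟨ζ, u, u.2⟩

/-- Lebesgue measure `du` on `ζᗮ`, regarded as a measure on the planes `u + ζ` parallel to `ζ`. -/
def fiberMeasure {n k : ℕ} (ζ : Gr n k) : Measure (Plane n k) :=
  (volume : Measure ζ.spaceᗮ).map (planeThrough ζ)

theorem orthogonal_rotate {n k : ℕ} (g : SO n) (ζ : Gr n k) :
    (ζ.rotate g).spaceᗮ = ζ.spaceᗮ.map ((rotate g).toLinearEquiv : _ →ₗ[ℝ] _) := by
  exact (Submodule.map_orthogonal_equiv ζ.space (rotate g)).symm

theorem rotate_mem {n k : ℕ} (g : SO n) {ζ : Gr n k} {u : EuclideanSpace ℝ (Fin n)}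
    (hu : u ∈ ζ.spaceᗮ) : rotate g u ∈ (ζ.rotate g).spaceᗮ := by
  rw [orthogonal_rotate]
  exact Submodule.mem_map_of_mem hu

theorem exists_isometry_rotate {n k : ℕ} (g : SO n) (ζ : Gr n k) :
    ∃ φ : ζ.spaceᗮ ≃ₗᵢ[ℝ] (ζ.rotate g).spaceᗮ,
      ∀ u, (φ u : EuclideanSpace ℝ (Fin n)) = rotate g (u : EuclideanSpace ℝ (Fin n)) := by
  rw [orthogonal_rotate]
  exact ⟨(rotate g).submoduleMap ζ.spaceᗮ, fun _ => rfl⟩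

theorem measurable_planeThrough {n k : ℕ} (ζ : Gr n k) : Measurable (planeThrough ζ) :=
  measurable_comap_iff.2 (measurable_const.prodMk measurable_subtype_coe)

theorem measurable_fiberMeasure {n k : ℕ} (hk : k ≤ n) :
    Measurable (fiberMeasure : Gr n k → Measure (Plane n k)) := by
  have h1 : Measurable fun g : SO n => (coordPlane hk).rotate g := (continuous_rotate _).measurable
  refine (Measurable.measurable_comp_iff_of_surjective h1 (rotate_surj hk)).1 ?_
  refine Measure.measurable_of_measurable_coe _ fun A hA => ?_
  have hc : Continuous fun p : SO n × (coordPlane hk).spaceᗮ =>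
      rotate p.1 (p.2 : EuclideanSpace ℝ (Fin n)) :=
    (continuous_euclideanCLM.comp continuous_fst).clm_apply
      (continuous_subtype_val.comp continuous_snd)
  have hΦ : Measurable fun p : SO n × (coordPlane hk).spaceᗮ =>
      (⟨(coordPlane hk).rotate p.1, rotate p.1 (p.2 : EuclideanSpace ℝ (Fin n)),
        rotate_mem p.1 p.2.2⟩ : Plane n k) :=
    measurable_comap_iff.2 ((h1.comp measurable_fst).prodMk hc.measurable)
  convert measurable_measure_prodMk_left (ν := (volume : Measure (coordPlane hk).spaceᗮ))
    (hΦ hA) using 1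
  ext1 g
  obtain ⟨φ, hφ⟩ := exists_isometry_rotate g (coordPlane hk)
  rw [Function.comp_apply, fiberMeasure, ← φ.measurePreserving.map_eq,
    Measure.map_map (measurable_planeThrough _) φ.continuous.measurable,
    Measure.map_apply ((measurable_planeThrough _).comp φ.continuous.measurable) hA]
  congr 1
  ext u
  simp only [Set.mem_preimage, Function.comp_apply, planeThrough, hφ]

/-- The measure `dτ = dζ du` on the manifold of `k`-planes:
`A ↦ ∫ |{u ∈ ζᗮ : u + ζ ∈ A}| dζ`. -/
def planeMeasure {n k : ℕ} (hk : k ≤ n) : Measure (Plane n k) :=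
  (grMeasure hk).bind fiberMeasure

theorem planeMeasure_apply {n k : ℕ} (hk : k ≤ n) {A : Set (Plane n k)} (hA : MeasurableSet A) :
    planeMeasure hk A = ∫⁻ ζ, (volume : Measure ζ.spaceᗮ)
      {u | planeThrough ζ u ∈ A} ∂(grMeasure hk) := by
  rw [planeMeasure, Measure.bind_apply hA (measurable_fiberMeasure hk).aemeasurable]
  exact lintegral_congr fun ζ => Measure.map_apply (measurable_planeThrough ζ) hA

/-- The restriction `v ↦ f (u + v)` of `f` to the plane `τ = u + ζ`, as a function on `ζ`. -/
def onPlane {n k : ℕ} {α : Type*} (f : EuclideanSpace ℝ (Fin n) → α) (τ : Plane n k) :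
    τ.dir.space → α :=
  fun v => f (τ.foot + v)

/-- The `k`-plane transform `(Rf)(ζ, u) = ∫_ζ f (u + v) dv` (with respect to Lebesgue measure on
the Euclidean space `ζ`) exists as an absolutely convergent integral, hence is finite. -/
def TransformFinite {n k : ℕ} {𝕜 : Type*} [RCLike 𝕜]
    (f : EuclideanSpace ℝ (Fin n) → 𝕜) (τ : Plane n k) : Prop :=
  Integrable (onPlane f τ) volume

/-- For a function `f` that is nonnegative on the plane `τ = u + ζ` (up to a null set): the
restriction of `f` to the plane is measurable and `(Rf)(ζ, u) = ∫_ζ f (u + v) dv = ∞`. -/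
def TransformInfinite {n k : ℕ} {𝕜 : Type*} [RCLike 𝕜]
    (f : EuclideanSpace ℝ (Fin n) → 𝕜) (τ : Plane n k) : Prop :=
  AEStronglyMeasurable (onPlane f τ) volume ∧
    ∫⁻ v, ENNReal.ofReal (RCLike.re (onPlane f τ v)) = ∞

/-- `f` is locally integrable on `ℝⁿ ∖ {0}`: integrable on every shell `a < |x| < b`. -/
def LocIntegrableAwayZero {n : ℕ} {𝕜 : Type*} [RCLike 𝕜]
    (f : EuclideanSpace ℝ (Fin n) → 𝕜) : Prop :=
  ∀ a b : ℝ, 0 < a → a < b → IntegrableOn f {x | a < ‖x‖ ∧ ‖x‖ < b} volume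

end

end KPlane

/-!
Both halves rest on the fact that integrability at infinity against `‖x‖ ^ (k - n)` is what a
typical `k`-plane sees.

For almost every plane: every plane is `g (u + ℝᵏ)` with `g ∈ SO(n)` and `u ⟂ ℝᵏ`
(`rotatedPlane`), and Tonelli turns the integral of a nonnegative `h` over all planes at distance
less than `b` from the origin into `∫ h(x) p_b(x) dx`, where `p_b(x)` (`nearProb`) is the
probability that the rotated plane through `x` passes within distance `b` of the origin
(`lintegral_transformLIntegral`). As `p_b` is radial, comparing its value at `x` with a mean over
the unit ball, which rotation invariance bounds by the volume of a product of two balls, gives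
`p_b(x) ≤ C / ‖x‖ ^ (n - k)` (`exists_nearProb_le`). Applied to `h = |f|` on `‖x‖ > a` this is
finite, and applied to the indicator of a null set it shows that `f` may be replaced by a Borel
representative.

For radial `f ≥ 0`: on a plane at distance `a` from the origin, polar coordinates and the
substitution `s = √(a² + r²)` turn the integral of `f` into
`∫ f₀(s) (s² - a²) ^ ((k - 2) / 2) s ds` up to a constant, whose density is comparable to
`s ^ (k - 1)` for large `s`. If it converges on one plane, then so does
`∫ f₀(s) s ^ (k - 1) ds` at infinity (`integrableOn_Ioi_of_integrableOn_sqrt`), which is the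
integrability condition on `f` in polar coordinates. The same substitution on compact intervals
gives measurability on every plane.
-/

namespace KPlane

/-! ### Radial functions and polar coordinates -/

section Radial

variable {F : Type*} [NormedAddCommGroup F] [NormedSpace ℝ F]

/-- Polar coordinates for integrability on a rotation invariant set away from the origin. -/
theorem integrableOn_fun_norm_iff {E : Type*} [NormedAddCommGroup E] [NormedSpace ℝ E]
    [MeasurableSpace E] [BorelSpace E] [FiniteDimensional ℝ E] [Nontrivial E]
    (μ : Measure E) [μ.IsAddHaarMeasure] {T : Set ℝ} (hT : MeasurableSet T)
    (hT0 : T ⊆ Set.Ioi 0) (H : ℝ → F) :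
    IntegrableOn (fun x : E => H ‖x‖) {x | ‖x‖ ∈ T} μ ↔
      IntegrableOn (fun r => r ^ (Module.finrank ℝ E - 1) • H r) T := by
  have h1 : MeasurableSet {x : E | ‖x‖ ∈ T} := measurable_norm hT
  have h2 : {x : E | ‖x‖ ∈ T}.indicator (fun x => H ‖x‖) = fun x => T.indicator H ‖x‖ := rfl
  have h3 : (fun r => r ^ (Module.finrank ℝ E - 1) • T.indicator H r) =
      T.indicator fun r => r ^ (Module.finrank ℝ E - 1) • H r := by
    ext1 r
    by_cases hr : r ∈ T <;> simp [hr]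
  rw [← integrable_indicator_iff h1, h2, integrable_fun_norm_addHaar, h3,
    IntegrableOn, integrable_indicator_iff hT, IntegrableOn, Measure.restrict_restrict hT,
    Set.inter_eq_left.2 hT0, IntegrableOn]

theorem hasDerivAt_sqrt_sq_add_sq (a : ℝ) {r : ℝ} (hr : 0 < r) :
    HasDerivAt (fun r => √(a ^ 2 + r ^ 2)) (r / √(a ^ 2 + r ^ 2)) r := by
  have h : HasDerivAt (fun r : ℝ => a ^ 2 + r ^ 2) (2 * r) r := by
    simpa using (hasDerivAt_pow 2 r).const_add (a ^ 2)
  convert h.sqrt (by positivity) using 1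
  field_simp

theorem injOn_sqrt_sq_add_sq (a : ℝ) {T : Set ℝ} (hT : T ⊆ Set.Ioi 0) :
    Set.InjOn (fun r => √(a ^ 2 + r ^ 2)) T := by
  intro r hr s hs h
  have h1 : √(a ^ 2 + r ^ 2) = √(a ^ 2 + s ^ 2) := h
  rw [Real.sqrt_inj (by positivity) (by positivity)] at h1
  exact (pow_left_inj₀ (hT hr).le (hT hs).le two_ne_zero).1 (by linarith)

/-- The substitution `s = √(a² + r²)`, which relates the distance `s` to the origin of a point of
a plane at distance `a` and its distance `r` to the foot of the plane. -/
theorem integrableOn_image_sqrt_iff (a : ℝ) {T : Set ℝ} (hT : MeasurableSet T)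
    (hT0 : T ⊆ Set.Ioi 0) (H : ℝ → F) :
    IntegrableOn H ((fun r => √(a ^ 2 + r ^ 2)) '' T) ↔
      IntegrableOn (fun r => (r / √(a ^ 2 + r ^ 2)) • H √(a ^ 2 + r ^ 2)) T := by
  rw [integrableOn_image_iff_integrableOn_abs_deriv_smul hT
    (fun r hr => (hasDerivAt_sqrt_sq_add_sq a (hT0 hr)).hasDerivWithinAt)
    (injOn_sqrt_sq_add_sq a hT0)]
  refine integrableOn_congr_fun (fun r hr => ?_) hT
  have : 0 < r := hT0 hr
  rw [abs_of_nonneg (by positivity)]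

/-- Multiplication by a function that is continuous on a compact interval preserves
integrability there; in particular the weights `r ^ m` are irrelevant away from `0` and `∞`. -/
theorem integrableOn_Icc_pow_smul_iff {a b : ℝ} (ha : 0 < a) (m : ℕ) (H : ℝ → F) :
    IntegrableOn (fun r => r ^ m • H r) (Set.Icc a b) ↔ IntegrableOn H (Set.Icc a b) := by
  refine ⟨fun h => ?_, fun h => h.continuousOn_smul (by fun_prop) isCompact_Icc⟩
  have hc : ContinuousOn (fun r : ℝ => (r ^ m)⁻¹) (Set.Icc a b) :=
    (continuous_pow m).continuousOn.inv₀ fun r hr => (pow_pos (ha.trans_le hr.1) m).ne'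
  refine (h.continuousOn_smul hc isCompact_Icc).congr_fun (fun r hr => ?_) measurableSet_Icc
  exact inv_smul_smul₀ (pow_pos (ha.trans_le hr.1) m).ne' (H r)

/-- The shells `a ≤ ‖x‖ ≤ b` exhaust the complement of the origin, which is conull. -/
theorem aestronglyMeasurable_of_shells {F E : Type*} [NormedAddCommGroup F] [NormedAddCommGroup E] [MeasurableSpace E]
    [BorelSpace E] {μ : Measure E} [NullSingletonClass μ] {G : E → F}
    (h : ∀ a b : ℝ, 0 < a → IntegrableOn G {x | ‖x‖ ∈ Set.Icc a b} μ) :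
    AEStronglyMeasurable G μ := by
  have hU : (⋃ j : ℕ, {x : E | ‖x‖ ∈ Set.Icc (1 / ((j : ℝ) + 1)) (j + 1)}) = {0}ᶜ := by
    ext x
    simp only [Set.mem_iUnion, Set.mem_ofPred_eq, Set.mem_compl_iff, Set.mem_singleton_iff]
    constructor
    · rintro ⟨j, hj, -⟩ rfl
      rw [norm_zero] at hj
      exact absurd hj (not_le.2 (by positivity))
    · intro hx
      obtain ⟨i, hi⟩ := exists_nat_one_div_lt (norm_pos_iff.2 hx)
      obtain ⟨j, hj⟩ := exists_nat_ge ‖x‖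
      refine ⟨max i j, ?_, ?_⟩
      · refine le_trans ?_ hi.le
        exact one_div_le_one_div_of_le (by positivity) (by simp)
      · have : (j : ℝ) ≤ (max i j : ℕ) := by simp
        linarith
  rw [← MeasureTheory.restrict_compl_singleton (μ := μ) 0, ← hU, aestronglyMeasurable_iUnion_iff]
  exact fun j => (h _ _ (by positivity)).aestronglyMeasurable

/-- If a radial profile is integrable on compact subintervals of `(0, ∞)`, then its restriction
to a plane at distance `a ≥ 0` from the origin is measurable. -/
theorem aestronglyMeasurable_fun_sqrt_norm {E : Type*} [NormedAddCommGroup E] [NormedSpace ℝ E]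
    [MeasurableSpace E] [BorelSpace E] [FiniteDimensional ℝ E] [Nontrivial E]
    (μ : Measure E) [μ.IsAddHaarMeasure] {H : ℝ → F}
    (hH : ∀ s t : ℝ, 0 < s → IntegrableOn H (Set.Icc s t)) (a : ℝ) :
    AEStronglyMeasurable (fun x : E => H √(a ^ 2 + ‖x‖ ^ 2)) μ := by
  refine aestronglyMeasurable_of_shells fun r t hr => ?_
  have hT0 : Set.Icc r t ⊆ Set.Ioi 0 := fun y hy => hr.trans_le hy.1
  rw [integrableOn_fun_norm_iff μ measurableSet_Icc hT0 (fun y => H √(a ^ 2 + y ^ 2)),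
    integrableOn_Icc_pow_smul_iff hr]
  have hsub : (fun r => √(a ^ 2 + r ^ 2)) '' Set.Icc r t ⊆
      Set.Icc √(a ^ 2 + r ^ 2) √(a ^ 2 + t ^ 2) := by
    rintro _ ⟨y, hy, rfl⟩
    have := hr.trans_le hy.1
    constructor <;> apply Real.sqrt_le_sqrt <;> gcongr
    exacts [hy.1, hy.2]
  have h1 := (integrableOn_image_sqrt_iff a measurableSet_Icc hT0 H).1
    ((hH _ _ (by positivity)).mono_set hsub)
  have hc : ContinuousOn (fun y : ℝ => (y / √(a ^ 2 + y ^ 2))⁻¹) (Set.Icc r t) := by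
    refine ContinuousOn.inv₀ (ContinuousOn.div continuousOn_id (by fun_prop) ?_) ?_ <;>
    · intro y hy
      have : 0 < y := hT0 hy
      positivity
  refine (h1.continuousOn_smul hc isCompact_Icc).congr_fun (fun y hy => ?_) measurableSet_Icc
  have : 0 < y := hT0 hy
  exact inv_smul_smul₀ (by positivity) _

/-- Convergence of the radial integral over a plane at distance `a` from the origin forces
convergence of `∫ s ^ (k - 1) H s ds` at infinity (with `m = k - 1`). -/
theorem integrableOn_Ioi_of_integrableOn_sqrt {H : ℝ → F} {a : ℝ} (ha : 0 ≤ a) (m : ℕ)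
    (h : IntegrableOn (fun r => r ^ m • H √(a ^ 2 + r ^ 2)) (Set.Ioi 0)) :
    IntegrableOn (fun s => s ^ m • H s) (Set.Ioi √(a ^ 2 + (a + 1) ^ 2)) := by
  have hT0 : Set.Ioi (a + 1) ⊆ Set.Ioi (0 : ℝ) := Set.Ioi_subset_Ioi (by linarith)
  have hsub : Set.Ioi √(a ^ 2 + (a + 1) ^ 2) ⊆
      (fun r => √(a ^ 2 + r ^ 2)) '' Set.Ioi (a + 1) := by
    intro s hs
    have hs0 : 0 < s := (Real.sqrt_nonneg _).trans_lt hs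
    have hs2 : a ^ 2 + (a + 1) ^ 2 < s ^ 2 := (Real.sqrt_lt' hs0).1 hs
    refine ⟨√(s ^ 2 - a ^ 2), Real.lt_sqrt_of_sq_lt (by linarith), ?_⟩
    have h0 : 0 ≤ s ^ 2 - a ^ 2 := by nlinarith [sq_nonneg (a + 1)]
    simp only [Real.sq_sqrt h0, add_sub_cancel]
    exact Real.sqrt_sq hs0.le
  refine IntegrableOn.mono_set ?_ hsub
  rw [integrableOn_image_sqrt_iff a measurableSet_Ioi hT0]
  have hw : Measurable fun r : ℝ => (r / √(a ^ 2 + r ^ 2)) * (√(a ^ 2 + r ^ 2) / r) ^ m := by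
    fun_prop
  -- The density `(r / s) * (s / r) ^ m` of the substitution is bounded, as `r ≤ s ≤ 2 * r`.
  have h1 := Integrable.bdd_smul (φ := fun r : ℝ =>
    (r / √(a ^ 2 + r ^ 2)) * (√(a ^ 2 + r ^ 2) / r) ^ m) (h.mono_set hT0)
    (2 ^ m) hw.aestronglyMeasurable ((ae_restrict_iff' measurableSet_Ioi).2 (.of_forall fun r hr => ?_))
  · refine IntegrableOn.congr_fun h1 (fun r hr => ?_) measurableSet_Ioi
    have hr0 : 0 < r := hT0 hr
    simp only [Pi.smul_apply', smul_smul]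
    congr 1
    field_simp
    rw [← mul_pow, div_mul_cancel₀ _ hr0.ne']
  · have hr0 : 0 < r := hT0 hr
    have har : a ≤ r := by have := Set.mem_Ioi.1 hr; linarith
    have h2 : r ≤ √(a ^ 2 + r ^ 2) := Real.le_sqrt_of_sq_le (by nlinarith)
    have h3 : √(a ^ 2 + r ^ 2) ≤ 2 * r := Real.sqrt_le_iff.2 ⟨by positivity, by nlinarith⟩
    rw [Real.norm_of_nonneg (by positivity)]
    calc _ ≤ 1 * (2 : ℝ) ^ m := by
          gcongr
          · exact div_le_one_of_le₀ h2 (by positivity)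
          · rwa [div_le_iff₀ hr0]
      _ = _ := one_mul _

end Radial

/-! ### Divergence on every plane for radial functions -/

theorem LocIntegrableAwayZero.integrableOn_profile {n : ℕ} (hn : 0 < n) {𝕜 : Type*} [RCLike 𝕜]
    {f : EuclideanSpace ℝ (Fin n) → 𝕜} (hf : LocIntegrableAwayZero f) {f₀ : ℝ → 𝕜}
    (hf₀ : ∀ x, x ≠ 0 → f x = f₀ ‖x‖) {s t : ℝ} (hs : 0 < s) :
    IntegrableOn f₀ (Set.Icc s t) := by
  have : NeZero n := ⟨hn.ne'⟩
  have hT0 : Set.Icc s t ⊆ Set.Ioi 0 := fun y hy => hs.trans_le hy.1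
  rw [← integrableOn_Icc_pow_smul_iff hs (n - 1)]
  have h := integrableOn_fun_norm_iff (E := EuclideanSpace ℝ (Fin n)) volume
    measurableSet_Icc hT0 f₀
  rw [finrank_euclideanSpace_fin] at h
  rw [← h]
  have h1 : IntegrableOn f {x | ‖x‖ ∈ Set.Icc s t} :=
    (hf (s / 2) (max t s + 1) (by positivity) (by linarith [le_max_right t s])).mono_set
      fun x hx => ⟨by linarith [hx.1], by linarith [hx.2, le_max_left t s]⟩
  refine h1.congr_fun (fun x hx => ?_) (measurable_norm measurableSet_Icc)
  exact hf₀ x (norm_pos_iff.1 (hT0 hx))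

/-- For a nonnegative radial function, a single plane with a finite `k`-plane transform suffices
for the integrability condition at infinity. -/
theorem transformInfinite_of_radial {𝕜 : Type*} [RCLike 𝕜] {n k : ℕ} (hk : 1 ≤ k) (hkn : k < n)
    {f : EuclideanSpace ℝ (Fin n) → 𝕜} (hf : LocIntegrableAwayZero f)
    (hpos : ∀ x, x ≠ 0 → 0 ≤ f x) {f₀ : ℝ → 𝕜} (hf₀ : ∀ x, x ≠ 0 → f x = f₀ ‖x‖)
    (hdiv : ¬ IntegrableOn (fun x => ‖f x‖ / ‖x‖ ^ (n - k)) {x | 1 < ‖x‖} volume)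
    (τ : Plane n k) : TransformInfinite f τ := by
  have hn : 0 < n := by omega
  have : NeZero n := ⟨hn.ne'⟩
  have hfr : Module.finrank ℝ τ.dir.space = k := τ.dir.finrank_space
  have : Nontrivial τ.dir.space := Module.nontrivial_of_finrank_pos (R := ℝ) (by omega)
  have hint : ∀ s t : ℝ, 0 < s → IntegrableOn f₀ (Set.Icc s t) :=
    fun s t hs => hf.integrableOn_profile hn hf₀ hs
  set a := ‖τ.foot‖
  have hne : ∀ v : τ.dir.space, v ≠ 0 → τ.foot + v ≠ 0 ∧ ‖τ.foot + v‖ = √(a ^ 2 + ‖v‖ ^ 2) := by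
    intro v hv
    have h1 : ‖τ.foot + v‖ ^ 2 = a ^ 2 + ‖v‖ ^ 2 := by
      have := norm_add_sq_eq_norm_sq_add_norm_sq_of_inner_eq_zero τ.foot (v : EuclideanSpace ℝ (Fin n))
        (Submodule.inner_left_of_mem_orthogonal v.2 τ.foot_mem)
      simpa [sq] using this
    have h2 : 0 < ‖v‖ := norm_pos_iff.2 hv
    refine ⟨fun h0 => ?_, by rw [← h1, Real.sqrt_sq (norm_nonneg _)]⟩
    rw [h0, norm_zero] at h1
    nlinarith [sq_nonneg a]
  have hae : ∀ᵐ v : τ.dir.space, v ≠ 0 := by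
    simp [ae_iff]
  have heq : onPlane f τ =ᵐ[volume] fun v => f₀ √(a ^ 2 + ‖v‖ ^ 2) := by
    filter_upwards [hae] with v hv
    rw [onPlane, hf₀ _ (hne v hv).1, (hne v hv).2]
  have hm : AEStronglyMeasurable (onPlane f τ) volume :=
    (aestronglyMeasurable_fun_sqrt_norm volume hint a).congr heq.symm
  refine ⟨hm, ?_⟩
  by_contra hfin
  have hI : Integrable (onPlane f τ) := by
    refine ⟨hm, ?_⟩
    rw [hasFiniteIntegral_iff_norm]
    refine lt_of_le_of_ne le_top ?_
    refine ne_of_eq_of_ne (lintegral_congr_ae ?_) hfin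
    filter_upwards [hae] with v hv
    have h := hpos _ (hne v hv).1
    have h1 : ‖f (τ.foot + v)‖ = RCLike.re (f (τ.foot + v)) := by
      simpa using congrArg RCLike.re (RCLike.norm_of_nonneg' h)
    rw [onPlane, h1]
  rw [integrable_congr heq, integrable_fun_norm_addHaar volume
    (f := fun r => f₀ √(a ^ 2 + r ^ 2)), hfr] at hI
  have h1 := integrableOn_Ioi_of_integrableOn_sqrt (norm_nonneg _) (k - 1) hI
  have h2 : IntegrableOn (fun s => s ^ (k - 1) • f₀ s) (Set.Ioi 1) := by
    refine (((integrableOn_Icc_pow_smul_iff one_pos (k - 1) f₀).2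
      (hint 1 √(a ^ 2 + (a + 1) ^ 2) one_pos)).union h1).mono_set fun s hs => ?_
    rcases le_or_gt s √(a ^ 2 + (a + 1) ^ 2) with h | h
    exacts [.inl ⟨(Set.mem_Ioi.1 hs).le, h⟩, .inr h]
  apply hdiv
  have h3 := integrableOn_fun_norm_iff (E := EuclideanSpace ℝ (Fin n)) volume measurableSet_Ioi
    (Set.Ioi_subset_Ioi zero_le_one) fun r => ‖f₀ r‖ / r ^ (n - k)
  rw [finrank_euclideanSpace_fin] at h3
  refine (h3.2 ?_).congr_fun (fun x hx => ?_) (measurable_norm measurableSet_Ioi)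
  · refine IntegrableOn.congr_fun h2.norm (fun r hr => ?_) measurableSet_Ioi
    have hr0 : (0 : ℝ) < r := zero_lt_one.trans hr
    have hp : r ^ (n - 1) = r ^ (k - 1) * r ^ (n - k) := by rw [← pow_add]; congr 1; omega
    simp only [norm_smul, norm_pow, Real.norm_of_nonneg hr0.le, smul_eq_mul, hp]
    field_simp
  · have hx0 : x ≠ 0 := norm_pos_iff.1 (zero_lt_one.trans (Set.mem_Ioi.1 hx))
    simp only [hf₀ x hx0]

/-! ### Planes as rotated translates of the coordinate plane -/

section Rotation

variable {n k : ℕ}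

theorem continuous_rotate_symm_apply :
    Continuous fun p : SO n × EuclideanSpace ℝ (Fin n) => (rotate p.1).symm p.2 := by
  simp_rw [rotate_symm_apply]
  have : Continuous fun g : SO n => star g := continuous_inv
  exact (continuous_euclideanCLM.comp (this.comp continuous_fst)).clm_apply continuous_snd

/-- The plane `g (u + ℝᵏ)` for a rotation `g` and `u ⟂ ℝᵏ`. -/
noncomputable def rotatedPlane (hk : k ≤ n) (p : SO n × (coordPlane hk).spaceᗮ) : Plane n k :=
  ⟨(coordPlane hk).rotate p.1, rotate p.1 (p.2 : EuclideanSpace ℝ (Fin n)), rotate_mem p.1 p.2.2⟩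

theorem measurable_rotatedPlane (hk : k ≤ n) : Measurable (rotatedPlane hk) := by
  have hc : Continuous fun p : SO n × (coordPlane hk).spaceᗮ =>
      rotate p.1 (p.2 : EuclideanSpace ℝ (Fin n)) :=
    (continuous_euclideanCLM.comp continuous_fst).clm_apply
      (continuous_subtype_val.comp continuous_snd)
  exact measurable_comap_iff.2
    (((continuous_rotate _).measurable.comp measurable_fst).prodMk hc.measurable)

theorem rotatedPlane_surjective (hk : k ≤ n) : Function.Surjective (rotatedPlane hk) := by
  rintro ⟨ζ, u, hu⟩
  obtain ⟨g, rfl⟩ := rotate_surj hk ζ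
  obtain ⟨φ, hφ⟩ := exists_isometry_rotate g (coordPlane hk)
  refine ⟨(g, φ.symm ⟨u, hu⟩), ?_⟩
  have h := hφ (φ.symm ⟨u, hu⟩)
  rw [φ.apply_symm_apply] at h
  simp only [rotatedPlane, ← h]

theorem measurable_foot : Measurable (Plane.foot : Plane n k → EuclideanSpace ℝ (Fin n)) :=
  measurable_snd.comp (comap_measurable _)

instance : MeasurableSpace.CountablySeparated (Plane n k) := by
  have : MeasurableSpace.CountablyGenerated (Plane n k) :=
    MeasurableSpace.CountablyGenerated.comap _
  have hinj : Function.Injective fun τ : Plane n k => (τ.dir, τ.foot) := by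
    rintro ⟨ζ, u, hu⟩ ⟨ζ', u', hu'⟩ h
    obtain ⟨rfl, rfl⟩ := Prod.mk.inj h
    rfl
  have : MeasurableSpace.SeparatesPoints (Plane n k) := by
    refine ⟨fun x y h => hinj ?_⟩
    by_contra hne
    have h1 := h _ ⟨{(x.dir, x.foot)}, measurableSet_singleton _, rfl⟩ rfl
    exact hne (Set.mem_singleton_iff.1 h1).symm
  exact MeasurableSpace.countablySeparated_of_separatesPoints

/-- The measure on planes is the image under `rotatedPlane` of the product of Haar measure and
Lebesgue measure on the orthogonal complement of `ℝᵏ`. -/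
theorem lintegral_planeMeasure (hk : k ≤ n) {F : Plane n k → ℝ≥0∞} (hF : Measurable F) :
    ∫⁻ τ, F τ ∂planeMeasure hk =
      ∫⁻ g, (∫⁻ u : (coordPlane hk).spaceᗮ, F (rotatedPlane hk (g, u))) ∂haarSO n := by
  have h1 : Measurable fun g : SO n => (coordPlane hk).rotate g := (continuous_rotate _).measurable
  rw [planeMeasure, Measure.lintegral_bind (measurable_fiberMeasure hk).aemeasurable
    hF.aemeasurable, grMeasure, lintegral_map
      (f := fun ζ => ∫⁻ τ, F τ ∂fiberMeasure ζ)
      ((Measure.measurable_lintegral hF).comp (measurable_fiberMeasure hk)) h1]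
  refine lintegral_congr fun g => ?_
  obtain ⟨φ, hφ⟩ := exists_isometry_rotate g (coordPlane hk)
  rw [fiberMeasure, lintegral_map hF (measurable_planeThrough _)]
  refine (φ.measurePreserving.lintegral_comp
    (hF.comp (measurable_planeThrough _))).symm.trans (lintegral_congr fun u => ?_)
  simp only [planeThrough, rotatedPlane, hφ, Function.comp_apply]

/-- The `k`-plane transform of a nonnegative function, with values in `[0, ∞]`. -/
noncomputable def transformLIntegral (h : EuclideanSpace ℝ (Fin n) → ℝ≥0∞) (τ : Plane n k) :
    ℝ≥0∞ :=
  ∫⁻ v, onPlane h τ v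

theorem transformLIntegral_rotatedPlane (hk : k ≤ n) {h : EuclideanSpace ℝ (Fin n) → ℝ≥0∞}
    (hh : Measurable h) (p : SO n × (coordPlane hk).spaceᗮ) :
    transformLIntegral h (rotatedPlane hk p) =
      ∫⁻ v : (coordPlane hk).space, h (rotate p.1 (p.2 + v)) := by
  let φ : (coordPlane hk).space ≃ₗᵢ[ℝ] ((coordPlane hk).rotate p.1).space :=
    (rotate p.1).submoduleMap (coordPlane hk).space
  have hm : Measurable (onPlane h (rotatedPlane hk p)) :=
    hh.comp (measurable_const.add measurable_subtype_coe)
  refine (φ.measurePreserving.lintegral_comp hm).symm.trans (lintegral_congr fun v => ?_)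
  rw [map_add]
  rfl

/-- The pull-back along the surjection `rotatedPlane` is measurable by Tonelli; its domain is
standard Borel, so measurability descends to the space of planes. -/
theorem measurable_transformLIntegral (hk : k ≤ n) {h : EuclideanSpace ℝ (Fin n) → ℝ≥0∞}
    (hh : Measurable h) : Measurable (transformLIntegral h : Plane n k → ℝ≥0∞) := by
  refine (Measurable.measurable_comp_iff_of_surjective (measurable_rotatedPlane hk)
    (rotatedPlane_surjective hk)).1 ?_
  have h1 : transformLIntegral h ∘ rotatedPlane hk = fun p =>
      ∫⁻ v : (coordPlane hk).space, h (rotate p.1 (p.2 + v)) :=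
    funext fun p => transformLIntegral_rotatedPlane hk hh p
  rw [h1]
  have hc : Continuous fun q : (SO n × (coordPlane hk).spaceᗮ) × (coordPlane hk).space =>
      rotate q.1.1 ((q.1.2 : EuclideanSpace ℝ (Fin n)) + q.2) :=
    (continuous_euclideanCLM.comp (continuous_fst.comp continuous_fst)).clm_apply
      ((continuous_subtype_val.comp (continuous_snd.comp continuous_fst)).add
        (continuous_subtype_val.comp continuous_snd))
  exact (hh.comp hc.measurable).lintegral_prod_right'

theorem lintegral_add_orthogonal {E : Type*} [NormedAddCommGroup E] [InnerProductSpace ℝ E]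
    [FiniteDimensional ℝ E] [MeasurableSpace E] [BorelSpace E] (W : Submodule ℝ E)
    {h : E → ℝ≥0∞} (hh : Measurable h) :
    ∫⁻ u : Wᗮ, ∫⁻ v : W, h (u + v) = ∫⁻ x, h x := by
  have e : MeasurePreserving fun p : W × Wᗮ => W.orthogonalDecomposition.symm (WithLp.toLp 2 p) :=
    W.orthogonalDecomposition.symm.measurePreserving.comp (WithLp.volume_preserving_toLp W Wᗮ)
  rw [← e.lintegral_comp hh, Measure.volume_eq_prod]
  refine Eq.trans ?_ (lintegral_prod_symm _ (hh.comp e.measurable).aemeasurable).symm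
  refine lintegral_congr fun u => lintegral_congr fun v => ?_
  rw [Function.comp_apply, Submodule.orthogonalDecomposition_symm_apply, add_comm]
  rfl

/-! ### The probability that a rotated plane through a point passes near the origin -/

/-- The probability that the plane with direction `g ℝᵏ` through `x`, for a Haar distributed
rotation `g`, lies at distance less than `b` from the origin. -/
noncomputable def nearProb (hk : k ≤ n) (b : ℝ) (x : EuclideanSpace ℝ (Fin n)) : ℝ≥0∞ :=
  haarSO n {g | ‖(coordPlane hk).spaceᗮ.starProjection ((rotate g).symm x)‖ < b}

theorem measurableSet_near (hk : k ≤ n) (b : ℝ) :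
    MeasurableSet {p : SO n × EuclideanSpace ℝ (Fin n) |
      ‖(coordPlane hk).spaceᗮ.starProjection ((rotate p.1).symm p.2)‖ < b} :=
  (isOpen_lt (((ContinuousLinearMap.continuous _).comp continuous_rotate_symm_apply).norm)
    continuous_const).measurableSet

theorem nearProb_le_one (hk : k ≤ n) (b : ℝ) (x : EuclideanSpace ℝ (Fin n)) :
    nearProb hk b x ≤ 1 := prob_le_one

theorem measurable_nearProb (hk : k ≤ n) (b : ℝ) : Measurable (nearProb hk b) :=
  measurable_measure_prodMk_right (measurableSet_near hk b)

/-- Integrating `h` over all planes at distance less than `b` from the origin amounts to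
integrating `h` over `ℝⁿ` against the probability that a random plane through a given point is
that close to the origin. -/
theorem lintegral_transformLIntegral (hk : k ≤ n) (b : ℝ)
    {h : EuclideanSpace ℝ (Fin n) → ℝ≥0∞} (hh : Measurable h) :
    ∫⁻ τ : Plane n k, {τ | ‖τ.foot‖ < b}.indicator (transformLIntegral h) τ ∂planeMeasure hk =
      ∫⁻ x, h x * nearProb hk b x := by
  set W := (coordPlane hk).space
  have hA : MeasurableSet {τ : Plane n k | ‖τ.foot‖ < b} :=
    measurableSet_lt measurable_foot.norm measurable_const
  have hB := measurableSet_near hk b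
  set B := {p : SO n × EuclideanSpace ℝ (Fin n) | ‖Wᗮ.starProjection ((rotate p.1).symm p.2)‖ < b}
  have hK : Measurable (B.indicator fun p => h p.2) := (hh.comp measurable_snd).indicator hB
  rw [lintegral_planeMeasure hk ((measurable_transformLIntegral hk hh).indicator hA)]
  calc _ = ∫⁻ g, (∫⁻ x, B.indicator (fun p => h p.2) (g, x)) ∂haarSO n := by
        refine lintegral_congr fun g => ?_
        have hKg : Measurable fun x => B.indicator (fun p => h p.2) (g, x) :=
          hK.comp measurable_prodMk_left
        rw [← (rotate g).measurePreserving.lintegral_comp hKg]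
        refine Eq.trans (lintegral_congr fun u => ?_)
          (lintegral_add_orthogonal W (hKg.comp (rotate g).continuous.measurable))
        have hu : ∀ v : W, Wᗮ.starProjection (u + v : EuclideanSpace ℝ (Fin n)) = u := by
          intro v
          rw [map_add, Submodule.starProjection_eq_self_iff.2 u.2,
            (Submodule.starProjection_apply_eq_zero_iff Wᗮ).2
              (Submodule.le_orthogonal_orthogonal W v.2), add_zero]
        have hmem : ∀ v : W, (g, rotate g (u + v)) ∈ B ↔ ‖u‖ < b := by
          intro v
          simp only [B, Set.mem_ofPred_eq, LinearIsometryEquiv.symm_apply_apply, hu]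
          rfl
        have hfoot : ‖(rotatedPlane hk (g, u)).foot‖ = ‖u‖ := (rotate g).norm_map u
        by_cases hub : ‖u‖ < b
        · rw [Set.indicator_of_mem (by simpa [hfoot] using hub),
            transformLIntegral_rotatedPlane hk hh]
          refine lintegral_congr fun v => ?_
          rw [Set.indicator_of_mem ((hmem v).2 hub)]
        · rw [Set.indicator_of_notMem (by simpa [hfoot] using hub)]
          symm
          rw [← lintegral_zero (μ := (volume : Measure W))]
          refine lintegral_congr fun v => ?_
          rw [Set.indicator_of_notMem (mt (hmem v).1 hub)]
    _ = ∫⁻ x, ∫⁻ g, B.indicator (fun p => h p.2) (g, x) ∂haarSO n :=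
        lintegral_lintegral_swap (f := fun g x => B.indicator (fun p => h p.2) (g, x))
          hK.aemeasurable
    _ = _ := by
        refine lintegral_congr fun x => ?_
        have hBx : MeasurableSet {g : SO n | (g, x) ∈ B} := measurable_prodMk_right hB
        have h1 : (fun g => B.indicator (fun p => h p.2) (g, x)) =
            {g : SO n | (g, x) ∈ B}.indicator fun _ => h x := rfl
        rw [h1, lintegral_indicator_const hBx]
        rfl

theorem nearProb_rotate (hk : k ≤ n) (b : ℝ) (g : SO n) (x : EuclideanSpace ℝ (Fin n)) :
    nearProb hk b (rotate g x) = nearProb hk b x := by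
  have h1 : MeasurePreserving (fun h : SO n => g * h) (haarSO n) (haarSO n) :=
    ⟨(continuous_const_mul g).measurable, by rw [haarSO]; exact map_mul_left_eq_self _ g⟩
  have hm : MeasurableSet {h : SO n |
      ‖(coordPlane hk).spaceᗮ.starProjection ((rotate h).symm (rotate g x))‖ < b} :=
    measurable_prodMk_right (measurableSet_near hk b)
  rw [nearProb, ← h1.measure_preimage hm.nullMeasurableSet, nearProb]
  congr 1
  ext h
  have h2 : (rotate (g * h)).symm (rotate g x) = (rotate h).symm x := by
    rw [LinearIsometryEquiv.symm_apply_eq]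
    have h3 : ∀ y, rotate (g * h) y = rotate g (rotate h y) := fun y => by
      simp only [rotate_apply, Submonoid.coe_mul, map_mul, mul_apply_eq_comp]
    rw [h3, LinearIsometryEquiv.apply_symm_apply]
  simp only [Set.mem_preimage, Set.mem_ofPred_eq, h2]

theorem nearProb_neg (hk : k ≤ n) (b : ℝ) (x : EuclideanSpace ℝ (Fin n)) :
    nearProb hk b (-x) = nearProb hk b x := by
  simp only [nearProb, map_neg, norm_neg]

/-- `nearProb` is radial: `SO(n)` acts transitively on lines, so every vector is a rotated
multiple of the first basis vector, and the remaining sign does not matter. -/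
theorem nearProb_eq_of_norm_eq (hk : k ≤ n) (b : ℝ) {x y : EuclideanSpace ℝ (Fin n)}
    (hxy : ‖x‖ = ‖y‖) : nearProb hk b x = nearProb hk b y := by
  rcases eq_or_ne x 0 with rfl | hx
  · rw [norm_eq_zero.1 (hxy.symm.trans norm_zero)]
  have hn : 1 ≤ n := by
    rcases Nat.eq_zero_or_pos n with rfl | h
    exacts [absurd (Subsingleton.elim x 0) hx, h]
  have key : ∀ z : EuclideanSpace ℝ (Fin n), z ≠ 0 → ∃ c : ℝ,
      nearProb hk b z = nearProb hk b (c • EuclideanSpace.single (Fin.castLE hn 0) 1) ∧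
        |c| = ‖z‖ := by
    intro z hz
    obtain ⟨g, hg⟩ := rotate_surj hn ⟨Submodule.span ℝ {z}, finrank_span_singleton hz⟩
    have hz1 : z ∈ ((coordPlane hn).rotate g).space := by
      have := congrArg Gr.space hg
      simp only at this
      rw [this]
      exact Submodule.mem_span_singleton_self z
    obtain ⟨w, hw, rfl⟩ := Submodule.mem_map.1 hz1
    have hw1 : w ∈ Submodule.span ℝ
        {EuclideanSpace.single (Fin.castLE hn (0 : Fin 1)) (1 : ℝ)} := by
      have hr : (Set.range fun i : Fin 1 => EuclideanSpace.single (Fin.castLE hn i) (1 : ℝ)) =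
          {EuclideanSpace.single (Fin.castLE hn (0 : Fin 1)) (1 : ℝ)} := Set.range_unique
      rw [← hr]
      exact hw
    obtain ⟨c, rfl⟩ := Submodule.mem_span_singleton.1 hw1
    refine ⟨c, nearProb_rotate hk b g _, ?_⟩
    have : ‖rotate g (c • EuclideanSpace.single (Fin.castLE hn (0 : Fin 1)) (1 : ℝ))‖ = |c| := by
      rw [LinearIsometryEquiv.norm_map, norm_smul, PiLp.norm_single, norm_one, mul_one,
        Real.norm_eq_abs]
    exact this.symm
  obtain ⟨c, hc, hc1⟩ := key x hx
  obtain ⟨d, hd, hd1⟩ := key y (norm_ne_zero_iff.1 (hxy ▸ norm_ne_zero_iff.2 hx))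
  rw [hc, hd]
  rcases abs_eq_abs.1 (hc1.trans (hxy.trans hd1.symm)) with rfl | rfl
  · rfl
  · rw [neg_smul, nearProb_neg]

/-- `nearProb` depends only on `b / ‖x‖`, and is monotone in it. -/
theorem nearProb_le_of_scale (hk : k ≤ n) {b c : ℝ} {x y : EuclideanSpace ℝ (Fin n)}
    (hx : 0 < ‖x‖) (hbc : ‖y‖ / ‖x‖ * b ≤ c) (hy : 0 < ‖y‖) :
    nearProb hk b x ≤ nearProb hk c y := by
  have hyn : ‖(‖y‖ / ‖x‖) • x‖ = ‖y‖ := by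
    rw [norm_smul, norm_div, norm_norm, norm_norm, div_mul_cancel₀ _ hx.ne']
  rw [← nearProb_eq_of_norm_eq hk c hyn]
  refine measure_mono fun g hg => ?_
  simp only [Set.mem_ofPred_eq, map_smul, norm_smul, norm_div, norm_norm] at hg ⊢
  exact (mul_lt_mul_of_pos_left hg (by positivity)).trans_le hbc

/-- By rotation invariance, the integral of `nearProb` over a ball is at most the volume of a
product of balls, of fixed radius in `ℝᵏ` and of radius `c` in its orthogonal complement. -/
theorem setLIntegral_nearProb_le (hk : k ≤ n) (hkn : k < n) (R : ℝ) :
    ∃ V : ℝ≥0∞, V ≠ ∞ ∧ ∀ c : ℝ, 0 ≤ c →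
      ∫⁻ x in Metric.ball (0 : EuclideanSpace ℝ (Fin n)) R, nearProb hk c x ≤
        V * ENNReal.ofReal (c ^ (n - k)) := by
  set W := (coordPlane hk).space
  have hW : Module.finrank ℝ Wᗮ = n - k := by
    have h1 := W.finrank_add_finrank_orthogonal
    have h2 : Module.finrank ℝ W = k := (coordPlane hk).finrank_space
    rw [finrank_euclideanSpace_fin] at h1
    omega
  have : Nontrivial Wᗮ := Module.nontrivial_of_finrank_pos (R := ℝ) (by omega)
  refine ⟨volume (Metric.ball (0 : W) R) * volume (Metric.ball (0 : Wᗮ) 1),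
    ENNReal.mul_ne_top measure_ball_lt_top.ne measure_ball_lt_top.ne, fun c hc => ?_⟩
  set h : EuclideanSpace ℝ (Fin n) → ℝ≥0∞ := (Metric.ball 0 R).indicator 1
  have hh : Measurable h := measurable_one.indicator measurableSet_ball
  have hA : MeasurableSet {τ : Plane n k | ‖τ.foot‖ < c} :=
    measurableSet_lt measurable_foot.norm measurable_const
  have h0 : ∫⁻ x in Metric.ball (0 : EuclideanSpace ℝ (Fin n)) R, nearProb hk c x =
      ∫⁻ x, h x * nearProb hk c x := by
    rw [← lintegral_indicator measurableSet_ball]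
    refine lintegral_congr fun x => ?_
    by_cases hx : x ∈ Metric.ball (0 : EuclideanSpace ℝ (Fin n)) R <;> simp [h, hx]
  rw [h0, ← lintegral_transformLIntegral hk c hh,
    lintegral_planeMeasure hk ((measurable_transformLIntegral hk hh).indicator hA)]
  have hbd : ∀ g : SO n, ∫⁻ u : Wᗮ, {τ : Plane n k | ‖τ.foot‖ < c}.indicator
      (transformLIntegral h) (rotatedPlane hk (g, u)) ≤
        volume (Metric.ball (0 : W) R) * volume (Metric.ball (0 : Wᗮ) c) := by
    intro g
    rw [← lintegral_indicator_const measurableSet_ball]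
    refine lintegral_mono fun u => ?_
    have hfoot : ‖(rotatedPlane hk (g, u)).foot‖ = ‖u‖ := (rotate g).norm_map u
    by_cases hu : ‖u‖ < c
    · rw [Set.indicator_of_mem (by simpa [hfoot] using hu),
        Set.indicator_of_mem (by simpa using hu), transformLIntegral_rotatedPlane hk hh,
        ← lintegral_indicator_one measurableSet_ball]
      refine lintegral_mono fun v => ?_
      by_cases hv : ‖(u : EuclideanSpace ℝ (Fin n)) + v‖ < R
      · have hvR : ‖v‖ < R := by
          refine lt_of_le_of_lt ?_ hv
          have h1 := norm_add_sq_eq_norm_sq_add_norm_sq_of_inner_eq_zero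
            (u : EuclideanSpace ℝ (Fin n)) v (Submodule.inner_left_of_mem_orthogonal v.2 u.2)
          refine abs_le_of_sq_le_sq' ?_ (norm_nonneg _) |>.2
          have h2 : ‖(v : EuclideanSpace ℝ (Fin n))‖ = ‖v‖ := rfl
          rw [h2] at h1
          linarith [mul_self_nonneg ‖(u : EuclideanSpace ℝ (Fin n))‖, sq ‖v‖,
            sq ‖(u : EuclideanSpace ℝ (Fin n)) + v‖]
        rw [Set.indicator_of_mem (s := Metric.ball (0 : W) R) (by simpa using hvR)]
        exact Set.indicator_le_self' (fun _ _ => zero_le) _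
      · have hm : rotate g (u + v) ∉ Metric.ball (0 : EuclideanSpace ℝ (Fin n)) R := by
          rwa [mem_ball_zero_iff, LinearIsometryEquiv.norm_map]
        simp only [h]
        rw [Set.indicator_of_notMem hm]
        exact zero_le
    · rw [Set.indicator_of_notMem (by simpa [hfoot] using hu)]
      exact zero_le
  refine (lintegral_mono hbd).trans ?_
  rw [lintegral_const, measure_univ, mul_one, Measure.addHaar_ball volume (0 : Wᗮ) hc, hW]
  exact le_of_eq (by ring)

/-- The orthogonal projection of a random unit vector to a subspace of dimension `n - k` has
length less than `s` with probability `O(s ^ (n - k))`; here `s = b / ‖x‖`. The probability at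
`x` is compared with its mean over the unit ball, so no formula for surface measure is needed. -/
theorem exists_nearProb_le (hk : k ≤ n) (hkn : k < n) {b : ℝ} (hb : 0 ≤ b) :
    ∃ C : ℝ≥0∞, C ≠ ∞ ∧ ∀ x : EuclideanSpace ℝ (Fin n), 0 < ‖x‖ →
      nearProb hk b x ≤ C * ENNReal.ofReal (1 / ‖x‖ ^ (n - k)) := by
  have : NeZero n := ⟨by omega⟩
  obtain ⟨V, hV, hle⟩ := setLIntegral_nearProb_le hk hkn 1
  have hM0 : volume (Metric.ball (0 : EuclideanSpace ℝ (Fin n)) 1) ≠ 0 :=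
    (Metric.measure_ball_pos volume 0 one_pos).ne'
  have hM1 : volume (Metric.ball (0 : EuclideanSpace ℝ (Fin n)) 1) ≠ ∞ := measure_ball_lt_top.ne
  refine ⟨V * ENNReal.ofReal (b ^ (n - k)) / volume (Metric.ball (0 : EuclideanSpace ℝ (Fin n)) 1),
    ENNReal.div_ne_top (ENNReal.mul_ne_top hV ENNReal.ofReal_ne_top) hM0, fun x hx => ?_⟩
  have h1 := hle (b / ‖x‖) (by positivity)
  have h2 : nearProb hk b x * volume (Metric.ball (0 : EuclideanSpace ℝ (Fin n)) 1) ≤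
      V * ENNReal.ofReal ((b / ‖x‖) ^ (n - k)) := by
    refine le_trans ?_ h1
    rw [← setLIntegral_const]
    refine lintegral_mono_ae ?_
    have hne : ∀ᵐ y : EuclideanSpace ℝ (Fin n), y ≠ 0 := by simp [ae_iff]
    filter_upwards [ae_restrict_mem measurableSet_ball, ae_restrict_of_ae hne] with y hy hy0
    refine nearProb_le_of_scale hk hx ?_ (norm_pos_iff.2 hy0)
    rw [div_mul_eq_mul_div]
    gcongr
    exact mul_le_of_le_one_left hb (mem_ball_zero_iff.1 hy).le
  have h3 : (b / ‖x‖) ^ (n - k) = b ^ (n - k) * (1 / ‖x‖ ^ (n - k)) := by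
    rw [div_pow, mul_one_div]
  rw [h3, ENNReal.ofReal_mul (by positivity)] at h2
  rw [div_eq_mul_inv, mul_right_comm, ← div_eq_mul_inv, ENNReal.le_div_iff_mul_le (.inl hM0) (.inl hM1)]
  simpa only [mul_assoc] using h2

/-! ### Finiteness of the transform on almost every plane -/

/-- A null set of `ℝⁿ` meets almost every plane in a null set. -/
theorem ae_transformLIntegral_eq_zero (hk : k ≤ n) {N : Set (EuclideanSpace ℝ (Fin n))}
    (hN : MeasurableSet N) (hN0 : volume N = 0) :
    ∀ᵐ τ : Plane n k ∂planeMeasure hk, transformLIntegral (N.indicator 1) τ = 0 := by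
  have hm : Measurable (N.indicator 1 : EuclideanSpace ℝ (Fin n) → ℝ≥0∞) :=
    measurable_one.indicator hN
  have h1 : ∀ j : ℕ, ∀ᵐ τ : Plane n k ∂planeMeasure hk,
      {τ | ‖τ.foot‖ < j}.indicator (transformLIntegral (N.indicator 1)) τ = 0 := by
    intro j
    refine (lintegral_eq_zero_iff ((measurable_transformLIntegral hk hm).indicator
      (measurableSet_lt measurable_foot.norm measurable_const))).1 ?_
    rw [lintegral_transformLIntegral hk _ hm,
      lintegral_eq_zero_iff (by exact hm.mul (measurable_nearProb hk _))]
    filter_upwards [measure_eq_zero_iff_ae_notMem.1 hN0] with x hx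
    simp [hx]
  filter_upwards [ae_all_iff.2 h1] with τ hτ
  obtain ⟨j, hj⟩ := exists_nat_gt ‖τ.foot‖
  simpa [hj] using hτ j

theorem ae_foot_ne_zero (hk : k ≤ n) (hkn : k < n) :
    ∀ᵐ τ : Plane n k ∂planeMeasure hk, τ.foot ≠ 0 := by
  have h0 : MeasurableSet {τ : Plane n k | τ.foot = 0} :=
    measurable_foot (measurableSet_singleton 0)
  rw [ae_iff]
  simp only [ne_eq, not_not]
  rw [planeMeasure_apply hk h0]
  refine lintegral_eq_zero_of_ae_eq_zero (.of_forall fun ζ => ?_)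
  have : Nontrivial ζ.spaceᗮ := by
    refine Module.nontrivial_of_finrank_pos (R := ℝ) ?_
    have h1 := ζ.space.finrank_add_finrank_orthogonal
    rw [finrank_euclideanSpace_fin, ζ.finrank_space] at h1
    omega
  have h : {u : ζ.spaceᗮ | planeThrough ζ u ∈ {τ : Plane n k | τ.foot = 0}} = {0} := by
    ext u
    simp [planeThrough]
  exact (congrArg volume h).trans (measure_singleton 0)

theorem LocIntegrableAwayZero.aestronglyMeasurable {𝕜 : Type*} [RCLike 𝕜] (hn : 0 < n)
    {f : EuclideanSpace ℝ (Fin n) → 𝕜} (hf : LocIntegrableAwayZero f) :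
    AEStronglyMeasurable f volume := by
  have : NeZero n := ⟨hn.ne'⟩
  refine aestronglyMeasurable_of_shells fun a b ha => ?_
  refine (hf (a / 2) (max a b + 1) (by positivity) (by linarith [le_max_left a b])).mono_set ?_
  exact fun x hx => ⟨by linarith [hx.1], by linarith [hx.2, le_max_right a b]⟩

/-- The part of the integral over planes at distance less than `b` that comes from `|x| > a` is
finite, by local integrability for `|x| < 2` and by `exists_nearProb_le` for `|x| > 1`. -/
theorem lintegral_mul_nearProb_lt_top {𝕜 : Type*} [RCLike 𝕜] (hk : k ≤ n) (hkn : k < n)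
    {f : EuclideanSpace ℝ (Fin n) → 𝕜} (hf : LocIntegrableAwayZero f)
    (hdec : IntegrableOn (fun x => ‖f x‖ / ‖x‖ ^ (n - k)) {x | 1 < ‖x‖} volume)
    {a b : ℝ} (ha : 0 < a) (hb : 0 ≤ b) :
    ∫⁻ x in {x | a < ‖x‖}, ‖f x‖ₑ * nearProb hk b x < ∞ := by
  have hsub : {x : EuclideanSpace ℝ (Fin n) | a < ‖x‖} ⊆
      {x | min a 1 < ‖x‖ ∧ ‖x‖ < 2} ∪ {x | 1 < ‖x‖} := by
    intro x hx
    rcases lt_or_ge ‖x‖ 2 with h | h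
    · exact .inl ⟨(min_le_left _ _).trans_lt hx, h⟩
    · exact .inr (one_lt_two.trans_le h)
  refine (lintegral_mono_set hsub).trans_lt ((lintegral_union_le _ _ _).trans_lt ?_)
  refine ENNReal.add_lt_top.2 ⟨?_, ?_⟩
  · have h1 := hf (min a 1) 2 (by positivity) (by linarith [min_le_right a 1])
    refine (lintegral_mono fun x => ?_).trans_lt h1.hasFiniteIntegral
    exact mul_le_of_le_one_right zero_le (nearProb_le_one hk b x)
  · obtain ⟨C, hC, hle⟩ := exists_nearProb_le hk hkn hb
    have hm : MeasurableSet {x : EuclideanSpace ℝ (Fin n) | 1 < ‖x‖} :=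
      measurableSet_lt measurable_const measurable_norm
    have h1 : ∫⁻ x in {x | 1 < ‖x‖}, ‖f x‖ₑ * nearProb hk b x ≤
        ∫⁻ x in {x | 1 < ‖x‖}, C * ‖‖f x‖ / ‖x‖ ^ (n - k)‖ₑ := by
      refine setLIntegral_mono' hm fun x hx => ?_
      have hx0 : 0 < ‖x‖ := zero_lt_one.trans hx
      refine (mul_le_mul_right (hle x hx0) _).trans (le_of_eq ?_)
      rw [Real.enorm_of_nonneg (by positivity), ← ofReal_norm, div_eq_mul_one_div ‖f x‖,
        ENNReal.ofReal_mul (norm_nonneg _)]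
      ring
    refine h1.trans_lt ?_
    rw [lintegral_const_mul' _ _ hC]
    exact ENNReal.mul_lt_top hC.lt_top hdec.hasFiniteIntegral

/-- Absolute convergence on almost every plane `τ`. Planes through the origin form a null set; on
a plane at distance in `(1 / (j + 1), j)` only the part `‖x‖ > 1 / (j + 1)` of `f` matters. -/
theorem ae_transformFinite {𝕜 : Type*} [RCLike 𝕜] (hk : k ≤ n) (hkn : k < n)
    {f : EuclideanSpace ℝ (Fin n) → 𝕜} (hf : LocIntegrableAwayZero f)
    (hdec : IntegrableOn (fun x => ‖f x‖ / ‖x‖ ^ (n - k)) {x | 1 < ‖x‖} volume) :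
    ∀ᵐ τ ∂planeMeasure hk, TransformFinite f τ := by
  have hfm := hf.aestronglyMeasurable (by omega)
  -- A strongly measurable representative `f'` of `f`, equal to `f` off a measurable null set `N`.
  set f' := hfm.mk f
  have hf' : StronglyMeasurable f' := hfm.stronglyMeasurable_mk
  set N := toMeasurable volume {x | f x ≠ f' x}
  have hN : MeasurableSet N := measurableSet_toMeasurable _ _
  have hN0 : volume N = 0 := by
    rw [measure_toMeasurable]
    exact hfm.ae_eq_mk
  have hNf : ∀ x, x ∉ N → f x = f' x := fun x hx => by
    by_contra h
    exact hx (subset_toMeasurable _ _ h)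
  set h : ℕ → EuclideanSpace ℝ (Fin n) → ℝ≥0∞ := fun j =>
    {x | 1 / ((j : ℝ) + 1) < ‖x‖}.indicator fun x => ‖f' x‖ₑ
  have hset : ∀ j : ℕ, MeasurableSet {x : EuclideanSpace ℝ (Fin n) | 1 / ((j : ℝ) + 1) < ‖x‖} :=
    fun j => measurableSet_lt measurable_const measurable_norm
  have hh : ∀ j, Measurable (h j) := fun j => hf'.enorm.indicator (hset j)
  have hfin : ∀ j : ℕ, ∀ᵐ τ : Plane n k ∂planeMeasure hk,
      {τ | ‖τ.foot‖ < j}.indicator (transformLIntegral (h j)) τ < ∞ := by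
    intro j
    refine ae_lt_top ((measurable_transformLIntegral hk (hh j)).indicator
      (measurableSet_lt measurable_foot.norm measurable_const)) ?_
    rw [lintegral_transformLIntegral hk _ (hh j)]
    refine ne_of_eq_of_ne ?_ (lintegral_mul_nearProb_lt_top hk hkn hf hdec
      (a := 1 / ((j : ℝ) + 1)) (b := j) (by positivity) (by positivity)).ne
    rw [← lintegral_indicator (hset j)]
    refine lintegral_congr_ae ?_
    filter_upwards [hfm.ae_eq_mk] with x hx
    by_cases hxj : 1 / ((j : ℝ) + 1) < ‖x‖
    · have hxj' : x ∈ {x : EuclideanSpace ℝ (Fin n) | 1 / ((j : ℝ) + 1) < ‖x‖} := hxj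
      simp only [h]
      rw [Set.indicator_of_mem hxj', Set.indicator_of_mem hxj', hx]
    · have hxj' : x ∉ {x : EuclideanSpace ℝ (Fin n) | 1 / ((j : ℝ) + 1) < ‖x‖} := hxj
      simp only [h]
      rw [Set.indicator_of_notMem hxj', Set.indicator_of_notMem hxj', zero_mul]
  filter_upwards [ae_all_iff.2 hfin, ae_transformLIntegral_eq_zero hk hN hN0,
    ae_foot_ne_zero hk hkn] with τ h1 h2 h3
  have hτ : Measurable fun v : τ.dir.space => τ.foot + (v : EuclideanSpace ℝ (Fin n)) :=
    measurable_const.add measurable_subtype_coe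
  have heq : onPlane f' τ =ᵐ[volume] onPlane f τ := by
    have hm : Measurable (onPlane (N.indicator (1 : EuclideanSpace ℝ (Fin n) → ℝ≥0∞)) τ) :=
      (measurable_one.indicator hN).comp hτ
    filter_upwards [(lintegral_eq_zero_iff hm).1 h2] with v hv
    refine (hNf _ fun hvN => ?_).symm
    simp [onPlane, hvN] at hv
  refine Integrable.congr ⟨(hf'.comp_measurable hτ).aestronglyMeasurable, ?_⟩ heq
  obtain ⟨i, hi⟩ := exists_nat_one_div_lt (norm_pos_iff.2 h3)
  obtain ⟨l, hl⟩ := exists_nat_gt ‖τ.foot‖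
  have hj1 : 1 / (((max i l : ℕ) : ℝ) + 1) < ‖τ.foot‖ :=
    (one_div_le_one_div_of_le (by positivity) (by simp)).trans_lt hi
  have hj2 : ‖τ.foot‖ < (max i l : ℕ) := hl.trans_le (by simp)
  have h4 := h1 (max i l)
  rw [Set.indicator_of_mem (s := {τ : Plane n k | ‖τ.foot‖ < (max i l : ℕ)}) hj2] at h4
  refine lt_of_le_of_lt (le_of_eq (lintegral_congr fun v => ?_)) h4
  -- Every point of the plane is at least as far from the origin as its foot.
  have hv : ‖τ.foot‖ ≤ ‖τ.foot + v‖ := by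
    have h5 := norm_add_sq_eq_norm_sq_add_norm_sq_of_inner_eq_zero τ.foot
      (v : EuclideanSpace ℝ (Fin n)) (Submodule.inner_left_of_mem_orthogonal v.2 τ.foot_mem)
    refine abs_le_of_sq_le_sq' ?_ (norm_nonneg _) |>.2
    nlinarith [mul_self_nonneg ‖(v : EuclideanSpace ℝ (Fin n))‖]
  have hmem : τ.foot + v ∈ {x : EuclideanSpace ℝ (Fin n) |
      1 / (((max i l : ℕ) : ℝ) + 1) < ‖x‖} := hj1.trans_le hv
  simp only [onPlane, h]
  rw [Set.indicator_of_mem hmem, Function.comp_apply]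

end Rotation

end KPlane

theorem theorem3p2 {𝕜 : Type*} [RCLike 𝕜] (n k : ℕ) (hk : 1 ≤ k) (hkn : k < n)
    (f : EuclideanSpace ℝ (Fin n) → 𝕜) (hf : KPlane.LocIntegrableAwayZero f) :
    (IntegrableOn (fun x => ‖f x‖ / ‖x‖ ^ (n - k)) {x | 1 < ‖x‖} volume →
      ∀ᵐ τ ∂(KPlane.planeMeasure hkn.le), KPlane.TransformFinite f τ) ∧
    ((∀ x, x ≠ 0 → 0 ≤ f x) →
      (∃ f₀ : ℝ → 𝕜, ∀ x, x ≠ 0 → f x = f₀ ‖x‖) →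
      ¬ IntegrableOn (fun x => ‖f x‖ / ‖x‖ ^ (n - k)) {x | 1 < ‖x‖} volume →
      ∀ τ : KPlane.Plane n k, KPlane.TransformInfinite f τ) := by
  refine ⟨KPlane.ae_transformFinite hkn.le hkn hf, ?_⟩
  rintro hpos ⟨f₀, hf₀⟩ hdiv
  exact KPlane.transformInfinite_of_radial hk hkn hf hpos hf₀ hdiv
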